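/- Call a function $f\colon\mathbb{Q}\to\mathbb{Q}$ (or a sequence of rationals) computable if it is computable with respect to a standard numbering of the rationals. A real $\alpha$ is left-c.e. if it is the limit of a computable nondecreasing sequence of rationals. For reals $\alpha,\beta$ write $\alpha\le_S^{tot}\beta$ ($\alpha$ is total Solovay reducible to $\beta$) if there are a rational constant $c>0$ and a total computable function $f\colon\mathbb{Q}\to\mathbb{Q}$ such that for all rationals $q<\beta$ it holds that $f(q)<\alpha$ and $\alpha-f(q)<c(\beta-q)$. Proposition. There exist left-c.e. reals $\alpha,\beta$ such that $\alpha\not\le_S^{tot}\alpha+\beta$. Consequently, addition is not an upper bound operator for $\le_S^{tot}$ on the left-c.e. reals (it is not true that $\alpha\le_S^{tot}\alpha+\beta$ and $\beta\le_S^{tot}\alpha+\beta$ for all left-c.e. reals $\alpha,\beta$), and hence not a join operator (it is not true that, for all left-c.e. reals $\alpha,\beta$, the sum $\alpha+\beta$ is a left-c.e. real that is a least upper bound of $\alpha$ and $\beta$ for $\le_S^{tot}$ among the left-c.e. reals). -/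

import Mathlib

/-- The standard numbering of the rationals by triples of natural numbers:
`(a, b, d)` is a name of `(a - b) / (d + 1)`. -/
def ratOfTriple (t : ℕ × ℕ × ℕ) : ℚ :=
  ((t.1 : ℚ) - (t.2.1 : ℚ)) / ((t.2.2 : ℚ) + 1)

/-- Every rational has a name. -/
theorem ratOfTriple_surjective : Function.Surjective ratOfTriple := by
  intro q
  refine ⟨(q.num.toNat, (-q.num).toNat, q.den - 1), ?_⟩
  have h1 : ((q.num.toNat : ℤ) - ((-q.num).toNat : ℤ)) = q.num := by omega
  have h2 : ((q.den - 1 : ℕ) : ℚ) + 1 = (q.den : ℚ) := by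
    exact_mod_cast Nat.sub_add_cancel q.den_pos
  have h3 : (((q.num.toNat : ℕ) : ℚ) - (((-q.num).toNat : ℕ) : ℚ)) = (q.num : ℚ) := by
    exact_mod_cast congrArg (Int.cast : ℤ → ℚ) h1
  simp only [ratOfTriple]
  rw [h2, h3]
  exact Rat.num_div_den q

/-- A sequence of rationals is computable if names of its members can be computed. -/
def ComputableRatSeq (a : ℕ → ℚ) : Prop :=
  ∃ A : ℕ → ℕ × ℕ × ℕ, Computable A ∧ ∀ n, a n = ratOfTriple (A n)

/-- A (total) function `f : ℚ → ℚ` is computable if from every name of `q`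
a name of `f q` can be computed. -/
def ComputableRatFun (f : ℚ → ℚ) : Prop :=
  ∃ F : ℕ × ℕ × ℕ → ℕ × ℕ × ℕ, Computable F ∧ ∀ t, f (ratOfTriple t) = ratOfTriple (F t)

/-- A real is left-c.e. if it is the limit of a computable nondecreasing sequence of rationals. -/
def LeftCE (α : ℝ) : Prop :=
  ∃ a : ℕ → ℚ, ComputableRatSeq a ∧ Monotone a ∧
    Filter.Tendsto (fun n => (a n : ℝ)) Filter.atTop (nhds α)

/-- `α` is total Solovay reducible to `β` with respect to the constant `c`. -/
def TotalSolovayReducibleWith (c : ℚ) (α β : ℝ) : Prop :=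
  ∃ f : ℚ → ℚ, ComputableRatFun f ∧
    ∀ q : ℚ, (q : ℝ) < β → (f q : ℝ) < α ∧ α - (f q : ℝ) < (c : ℝ) * (β - (q : ℝ))

/-- `α` is total Solovay reducible to `β`. -/
def TotalSolovayReducible (α β : ℝ) : Prop :=
  ∃ c : ℚ, 0 < c ∧ TotalSolovayReducibleWith c α β

/-- `γ` is an upper bound of `α` and `β` with respect to total Solovay reducibility. -/
def IsTotalSolovayUpperBound (α β γ : ℝ) : Prop :=
  TotalSolovayReducible α γ ∧ TotalSolovayReducible β γ

/-- `γ` is a join (least upper bound) of `α` and `β` with respect to total Solovay reducibility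
on the left-c.e. reals. -/
def IsTotalSolovayJoin (α β γ : ℝ) : Prop :=
  LeftCE γ ∧ IsTotalSolovayUpperBound α β γ ∧
    ∀ δ : ℝ, LeftCE δ → IsTotalSolovayUpperBound α β δ → TotalSolovayReducible γ δ

open Nat.Partrec (Code)

namespace SolovaySum

/-! Diagonalization against every pair of a computable function `f` and a constant. Level `e` holds
cells for `α` and `β` with indices `(x, y)`. With `m = 3e + 3`, it cuts each into `2m + 1` subcells
and tests `f` at `q`, the point with index `(2m + 1)(x + y) + 2m` on the finer grid. Until `f q`
halts, the digits are `(0, 0)`. Then both rise, to `(1, 2m)` or `(2m, 1)`, and either way `q < α + β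
≤ q + 3 / scale (e + 1)`. If `f q` reaches the middle of the cell of `α`, the choice `(1, 2m)` keeps
`α` below `f q`. Otherwise `(2m, 1)` puts `α` more than `m` subcells above `f q`, too far for any
constant `c ≤ e`. Since digits only rise at a fixed parent cell, both reals are left-c.e.
(`cell_eq_or_lt`); each level stabilizes (`exists_cell_stable`). -/

/-- The refinement factor of level `e`. -/
def factor (e : ℕ) : ℕ := 6 * e + 7

/-- The number of cells per unit length at level `n`. -/
def scale (n : ℕ) : ℕ := Nat.rec 1 (fun e K => K * factor e) n

/-- The name of the rational at which level `e` tests its function, in the cell `(x, y)`. -/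
def testPoint (e : ℕ) (p : ℕ × ℕ) : ℕ × ℕ × ℕ :=
  (factor e * (p.1 + p.2) + 2 * (3 * e + 3), 0, scale (e + 1) - 1)

/-- The digits by which the cell is refined, given the value (if any) of the tested function:
the first coordinate stays below the value if the value is large, and passes it otherwise. -/
def digits (e : ℕ) (p : ℕ × ℕ) (v : Option ℕ) : ℕ × ℕ :=
  Option.casesOn v (0, 0) fun r =>
    if (factor e * p.1 + (3 * e + 3)) * (r.unpair.2.unpair.2 + 1)
        + scale (e + 1) * r.unpair.2.unpair.1 ≤ scale (e + 1) * r.unpair.1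
    then (1, 2 * (3 * e + 3)) else (2 * (3 * e + 3), 1)

/-- The result, within `s` steps, of the function tested at level `e`. -/
def testValue (s e : ℕ) (p : ℕ × ℕ) : Option ℕ :=
  Code.evaln s (Denumerable.ofNat Code e.unpair.1) (Encodable.encode (testPoint e p))

/-- Refinement of a cell of level `e` to one of level `e + 1`. -/
def refine (s e : ℕ) (p : ℕ × ℕ) : ℕ × ℕ :=
  (factor e * p.1 + (digits e p (testValue s e p)).1,
    factor e * p.2 + (digits e p (testValue s e p)).2)

/-- The cell of level `n` chosen with computations of length `s`. -/
def cell (s n : ℕ) : ℕ × ℕ := Nat.rec (0, 0) (fun e p => refine s e p) n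

theorem cell_succ (s n : ℕ) : cell s (n + 1) = refine s n (cell s n) := rfl

theorem scale_zero : scale 0 = 1 := rfl

theorem scale_succ (n : ℕ) : scale (n + 1) = scale n * factor n := rfl

theorem scale_pos (n : ℕ) : 0 < scale n := by
  induction n with
  | zero => exact Nat.one_pos
  | succ n ih => exact Nat.mul_pos ih (by simp [factor])

/-! ### Computability -/

theorem primrec_factor : Primrec factor :=
  Primrec.nat_add.comp (Primrec.nat_mul.comp (Primrec.const 6) Primrec.id) (Primrec.const 7)

theorem primrec_scale : Primrec scale :=
  Primrec.nat_rec₁ 1 (Primrec.nat_mul.comp Primrec.snd (primrec_factor.comp Primrec.fst))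

theorem primrec_threshold : Primrec fun e : ℕ => 3 * e + 3 :=
  Primrec.nat_add.comp (Primrec.nat_mul.comp (Primrec.const 3) Primrec.id) (Primrec.const 3)

theorem primrec_testPoint : Primrec₂ testPoint := by
  have h : Primrec fun x : ℕ × ℕ × ℕ => 2 * (3 * x.1 + 3) :=
    Primrec.nat_mul.comp (Primrec.const 2) (primrec_threshold.comp Primrec.fst)
  exact Primrec.pair
    (Primrec.nat_add.comp
      (Primrec.nat_mul.comp (primrec_factor.comp Primrec.fst)
        (Primrec.nat_add.comp (Primrec.fst.comp Primrec.snd) (Primrec.snd.comp Primrec.snd))) h)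
    (Primrec.pair (Primrec.const 0)
      (Primrec.nat_sub.comp (primrec_scale.comp (Primrec.succ.comp Primrec.fst))
        (Primrec.const 1)))

theorem primrec_testValue : Primrec fun x : ℕ × ℕ × ℕ × ℕ => testValue x.1 x.2.1 x.2.2 := by
  have he : Primrec fun x : ℕ × ℕ × ℕ × ℕ => x.2.1 := Primrec.fst.comp Primrec.snd
  exact Code.primrec_evaln.comp
    (Primrec.pair
      (Primrec.pair Primrec.fst
        ((Primrec.ofNat Code).comp (Primrec.fst.comp (Primrec.unpair.comp he))))
      (Primrec.encode.comp (primrec_testPoint.comp he (Primrec.snd.comp Primrec.snd))))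

theorem primrec_digits :
    Primrec fun x : (ℕ × ℕ × ℕ) × Option ℕ => digits x.1.1 x.1.2 x.2 := by
  have he : Primrec fun x : ((ℕ × ℕ × ℕ) × Option ℕ) × ℕ => x.1.1.1 :=
    Primrec.fst.comp (Primrec.fst.comp Primrec.fst)
  have hp : Primrec fun x : ((ℕ × ℕ × ℕ) × Option ℕ) × ℕ => x.1.1.2.1 :=
    Primrec.fst.comp (Primrec.snd.comp (Primrec.fst.comp Primrec.fst))
  have hr : Primrec fun x : ((ℕ × ℕ × ℕ) × Option ℕ) × ℕ => x.2.unpair :=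
    Primrec.unpair.comp Primrec.snd
  have hr' : Primrec fun x : ((ℕ × ℕ × ℕ) × Option ℕ) × ℕ => x.2.unpair.2.unpair :=
    Primrec.unpair.comp (Primrec.snd.comp hr)
  have hK : Primrec fun x : ((ℕ × ℕ × ℕ) × Option ℕ) × ℕ => scale (x.1.1.1 + 1) :=
    primrec_scale.comp (Primrec.succ.comp he)
  have hm := primrec_threshold.comp he
  have h2m := Primrec.nat_mul.comp (Primrec.const 2) hm
  refine Primrec.option_casesOn (o := fun x : (ℕ × ℕ × ℕ) × Option ℕ => x.2)
    Primrec.snd (Primrec.const (0, 0)) ?_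
  exact Primrec.ite
    (Primrec.nat_le.comp
      (Primrec.nat_add.comp
        (Primrec.nat_mul.comp
          (Primrec.nat_add.comp (Primrec.nat_mul.comp (primrec_factor.comp he) hp) hm)
          (Primrec.succ.comp (Primrec.snd.comp hr')))
        (Primrec.nat_mul.comp hK (Primrec.fst.comp hr')))
      (Primrec.nat_mul.comp hK (Primrec.fst.comp hr)))
    (Primrec.pair (Primrec.const 1) h2m) (Primrec.pair h2m (Primrec.const 1))

theorem primrec_refine : Primrec fun x : ℕ × ℕ × ℕ × ℕ => refine x.1 x.2.1 x.2.2 := by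
  have hd : Primrec fun x : ℕ × ℕ × ℕ × ℕ =>
      digits x.2.1 x.2.2 (testValue x.1 x.2.1 x.2.2) :=
    Primrec.comp (g := fun x : ℕ × ℕ × ℕ × ℕ => (x.2, testValue x.1 x.2.1 x.2.2))
      primrec_digits (Primrec.pair Primrec.snd primrec_testValue)
  have hM : Primrec fun x : ℕ × ℕ × ℕ × ℕ => factor x.2.1 :=
    primrec_factor.comp (Primrec.fst.comp Primrec.snd)
  have hp : Primrec fun x : ℕ × ℕ × ℕ × ℕ => x.2.2 := Primrec.snd.comp Primrec.snd
  exact Primrec.pair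
    (Primrec.nat_add.comp (Primrec.nat_mul.comp hM (Primrec.fst.comp hp)) (Primrec.fst.comp hd))
    (Primrec.nat_add.comp (Primrec.nat_mul.comp hM (Primrec.snd.comp hp)) (Primrec.snd.comp hd))

theorem primrec_cell : Primrec fun s => cell s s :=
  Primrec.nat_rec' (f := fun s : ℕ => s) (g := fun _ => ((0, 0) : ℕ × ℕ))
    (h := fun s x => refine s x.1 x.2) Primrec.id (Primrec.const (0, 0)) primrec_refine

theorem computableRatSeq_div_scale {x : ℕ → ℕ} (hx : Primrec x) :
    ComputableRatSeq fun s => (x s : ℚ) / scale s := by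
  refine ⟨fun s => (x s, 0, scale s - 1), ?_, fun s => ?_⟩
  · exact (Primrec.pair hx (Primrec.pair (Primrec.const 0)
      (Primrec.nat_sub.comp primrec_scale (Primrec.const 1)))).to_comp
  · have h : ((scale s - 1 : ℕ) : ℚ) + 1 = scale s := by
      exact_mod_cast Nat.sub_add_cancel (scale_pos s)
    simp [ratOfTriple, h]

/-! ### Monotonicity of the cells -/

theorem digits_lt (e : ℕ) (p : ℕ × ℕ) (v : Option ℕ) :
    (digits e p v).1 + 1 ≤ factor e ∧ (digits e p v).2 + 1 ≤ factor e := by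
  cases v with
  | none => simp [digits, factor]
  | some r =>
    simp only [digits]
    split_ifs <;> constructor <;> simp only [factor] <;> omega

theorem one_le_digits_some (e : ℕ) (p : ℕ × ℕ) (r : ℕ) :
    1 ≤ (digits e p (some r)).1 ∧ 1 ≤ (digits e p (some r)).2 := by
  simp only [digits]
  split_ifs <;> constructor <;> omega

theorem testValue_mono {s t : ℕ} (h : s ≤ t) (e : ℕ) (p : ℕ × ℕ) :
    testValue s e p = testValue t e p ∨
      testValue s e p = none ∧ ∃ r, testValue t e p = some r := by
  rcases hs : testValue s e p with _ | r
  · rcases ht : testValue t e p with _ | r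
    · exact Or.inl rfl
    · exact Or.inr ⟨rfl, r, rfl⟩
  · exact Or.inl (Code.evaln_mono h hs).symm

/-- A newly halting test raises both digits from 0. A gain of one at level `n` is worth `factor n`
at the next level, which outweighs any reset of digits there, as these are below `factor n`. -/
theorem cell_eq_or_lt {s t : ℕ} (h : s ≤ t) (n : ℕ) :
    cell s n = cell t n ∨ (cell s n).1 + 1 ≤ (cell t n).1 ∧ (cell s n).2 + 1 ≤ (cell t n).2 := by
  induction n with
  | zero => exact Or.inl rfl
  | succ n ih =>
    rw [cell_succ, cell_succ]
    rcases ih with ih | ⟨h1, h2⟩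
    · rw [ih]
      rcases testValue_mono h n (cell t n) with hv | ⟨hs, r, ht⟩
      · left; simp only [refine, hv]
      · right
        have := one_le_digits_some n (cell t n) r
        simp only [refine, hs, ht]
        simp only [digits] at this ⊢
        omega
    · right
      have hd := digits_lt n (cell s n) (testValue s n (cell s n))
      have e1 := Nat.mul_le_mul_left (factor n) h1
      have e2 := Nat.mul_le_mul_left (factor n) h2
      simp only [refine]
      rw [Nat.mul_add] at e1 e2
      omega

theorem cell_lt_scale (s n : ℕ) : (cell s n).1 + 1 ≤ scale n := by
  induction n with
  | zero => exact le_rfl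
  | succ n ih =>
    have hd := (digits_lt n (cell s n) (testValue s n (cell s n))).1
    have e := Nat.mul_le_mul_left (factor n) ih
    rw [cell_succ, scale_succ, Nat.mul_comm]
    simp only [refine]
    rw [Nat.mul_add] at e
    omega

/-- The first coordinate is bounded, and any later change of the cell would raise it above its
maximum. -/
theorem exists_cell_stable (n : ℕ) : ∃ s, ∀ t, s ≤ t → cell t n = cell s n := by
  have hbdd : BddAbove (Set.range fun s => (cell s n).1) :=
    ⟨scale n, by rintro _ ⟨s, rfl⟩; exact (Nat.le_succ _).trans (cell_lt_scale s n)⟩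
  obtain ⟨s, hs⟩ := Nat.sSup_mem (Set.range_nonempty fun s => (cell s n).1) hbdd
  refine ⟨s, fun t hst => ?_⟩
  rcases cell_eq_or_lt hst n with h | ⟨h, -⟩
  · exact h.symm
  · have : (cell t n).1 ≤ (cell s n).1 := (le_csSup hbdd ⟨t, rfl⟩).trans hs.ge
    omega

/-! ### Left-c.e. limits of nested cells -/

/-- A sequence of nested cells, with stages: `x s n` is the index of an interval of length
`1 / scale n`. -/
structure Nested (x : ℕ → ℕ → ℕ) : Prop where
  refines : ∀ s n, factor n * x s n ≤ x s (n + 1) ∧ x s (n + 1) + 1 ≤ factor n * (x s n + 1)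
  mono : ∀ s t n, s ≤ t → x s n ≤ x t n
  zero : ∀ s, x s 0 = 0

theorem nested_fst : Nested fun s n => (cell s n).1 where
  refines s n := by
    have := (digits_lt n (cell s n) (testValue s n (cell s n))).1
    simp only [cell_succ, refine, Nat.mul_add]
    omega
  mono s t n h := by
    rcases cell_eq_or_lt h n with h | h
    · exact (congrArg Prod.fst h).le
    · omega
  zero _ := rfl

theorem nested_snd : Nested fun s n => (cell s n).2 where
  refines s n := by
    have := (digits_lt n (cell s n) (testValue s n (cell s n))).2
    simp only [cell_succ, refine, Nat.mul_add]
    omega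
  mono s t n h := by
    rcases cell_eq_or_lt h n with h | h
    · exact (congrArg Prod.snd h).le
    · omega
  zero _ := rfl

theorem scale_cast_pos (n : ℕ) : (0 : ℚ) < scale n := by exact_mod_cast scale_pos n

theorem Nested.monotone_left {x : ℕ → ℕ → ℕ} (hx : Nested x) (s : ℕ) :
    Monotone fun n => (x s n : ℚ) / scale n := by
  refine monotone_nat_of_le_succ fun n => ?_
  have h : (factor n * x s n : ℚ) ≤ x s (n + 1) := by exact_mod_cast (hx.refines s n).1
  rw [div_le_div_iff₀ (scale_cast_pos _) (scale_cast_pos _), scale_succ]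
  push_cast
  nlinarith [scale_cast_pos n]

theorem Nested.antitone_right {x : ℕ → ℕ → ℕ} (hx : Nested x) (s : ℕ) :
    Antitone fun n => ((x s n : ℚ) + 1) / scale n := by
  refine antitone_nat_of_succ_le fun n => ?_
  have h : (x s (n + 1) + 1 : ℚ) ≤ factor n * (x s n + 1) := by
    exact_mod_cast (hx.refines s n).2
  rw [div_le_div_iff₀ (scale_cast_pos _) (scale_cast_pos _), scale_succ]
  push_cast
  nlinarith [scale_cast_pos n]

theorem Nested.monotone_diag {x : ℕ → ℕ → ℕ} (hx : Nested x) :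
    Monotone fun s => (x s s : ℚ) / scale s := by
  -- Refine by one level at the fixed stage `s`, then advance the stage at the fixed level `s + 1`.
  refine monotone_nat_of_le_succ fun s => (hx.monotone_left s s.le_succ).trans ?_
  have := hx.mono s (s + 1) (s + 1) s.le_succ
  dsimp only
  gcongr

/-- The limit of the diagonal left endpoints lies in every stabilized cell, because late diagonal
cells are nested in it. -/
theorem Nested.exists_limit {x : ℕ → ℕ → ℕ} (hx : Nested x) (hc : Primrec fun s => x s s) :
    ∃ α : ℝ, LeftCE α ∧ ∀ n k s, (∀ t, s ≤ t → x t n = k) →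
      (k : ℝ) ≤ α * scale n ∧ α * scale n ≤ k + 1 := by
  have hmono : Monotone fun s => (((x s s : ℚ) / scale s : ℚ) : ℝ) := fun s t h => by
    have := hx.monotone_diag h
    dsimp only at this ⊢
    exact_mod_cast this
  have hbdd : BddAbove (Set.range fun s => (((x s s : ℚ) / scale s : ℚ) : ℝ)) := by
    refine ⟨1, ?_⟩
    rintro _ ⟨s, rfl⟩
    have h := hx.antitone_right s (Nat.zero_le s)
    simp only [hx.zero, scale_zero, Nat.cast_zero, zero_add, Nat.cast_one, div_one] at h
    have h' : (x s s : ℚ) / scale s ≤ (x s s + 1) / scale s := by gcongr; simp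
    simpa using (Rat.cast_le (K := ℝ)).2 (h'.trans h)
  have hlim := tendsto_atTop_ciSup hmono hbdd
  refine ⟨_, ⟨_, computableRatSeq_div_scale hc, hx.monotone_diag, hlim⟩, fun n k s hk => ?_⟩
  have hK : (0 : ℝ) < scale n := by exact_mod_cast scale_pos n
  rw [← div_le_iff₀ hK, ← le_div_iff₀ hK]
  constructor
  · refine ge_of_tendsto hlim (Filter.eventually_atTop.2 ⟨max s n, fun t ht => ?_⟩)
    have h := hx.monotone_left t ((le_max_right _ _).trans ht)
    dsimp only at h
    rw [hk t ((le_max_left _ _).trans ht)] at h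
    simpa using (Rat.cast_le (K := ℝ)).2 h
  · refine le_of_tendsto hlim (Filter.eventually_atTop.2 ⟨max s n, fun t ht => ?_⟩)
    have h := hx.antitone_right t ((le_max_right _ _).trans ht)
    dsimp only at h
    rw [hk t ((le_max_left _ _).trans ht)] at h
    have h' : (x t t : ℚ) / scale t ≤ (x t t + 1) / scale t := by gcongr; simp
    simpa using (Rat.cast_le (K := ℝ)).2 (h'.trans h)

/-! ### Diagonalization -/

theorem exists_code_of_computable {F : ℕ × ℕ × ℕ → ℕ × ℕ × ℕ} (hF : Computable F) :
    ∃ c : Code, ∀ t, Encodable.encode (F t) ∈ c.eval (Encodable.encode t) := by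
  obtain ⟨c, hc⟩ := Code.exists_code.1 hF
  refine ⟨c, fun t => ?_⟩
  simp only [hc, Encodable.encodek, Part.coe_some, Part.bind_some]
  exact Part.mem_map _ (Part.mem_some _)

/-- If the function with code `c` is total, then the cells after a level `e` that tests it
are eventually those obtained from the value of the function at the test point. -/
theorem exists_refine_eq {F : ℕ × ℕ × ℕ → ℕ × ℕ × ℕ} {c : Code}
    (hc : ∀ t, Encodable.encode (F t) ∈ c.eval (Encodable.encode t)) {e : ℕ}
    (he : e.unpair.1 = Encodable.encode c) :
    ∃ (p : ℕ × ℕ) (s : ℕ), ∀ t, s ≤ t → cell t (e + 1) =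
      (factor e * p.1 + (digits e p (some (Encodable.encode (F (testPoint e p))))).1,
        factor e * p.2 + (digits e p (some (Encodable.encode (F (testPoint e p))))).2) := by
  obtain ⟨s, hs⟩ := exists_cell_stable e
  obtain ⟨k, hk⟩ := Code.evaln_complete.1 (hc (testPoint e (cell s e)))
  refine ⟨cell s e, max s k, fun t ht => ?_⟩
  have hv : testValue t e (cell s e) = some (Encodable.encode (F (testPoint e (cell s e)))) := by
    rw [testValue, he, Denumerable.ofNat_encode]
    exact Code.evaln_mono ((le_max_right _ _).trans ht) hk
  rw [cell_succ, hs t ((le_max_left _ _).trans ht), refine, hv]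

/-- The comparison in `digits` is this inequality with the denominator cleared and the subtracted
part moved across, so that it takes place in `ℕ`. -/
theorem digits_encode (e : ℕ) (p : ℕ × ℕ) (r : ℕ × ℕ × ℕ) :
    digits e p (some (Encodable.encode r)) =
      if (((factor e * p.1 + (3 * e + 3) : ℕ) : ℝ) ≤ (ratOfTriple r : ℝ) * scale (e + 1))
      then (1, 2 * (3 * e + 3)) else (2 * (3 * e + 3), 1) := by
  obtain ⟨a, b, d⟩ := r
  have h : ((factor e * p.1 + (3 * e + 3)) * (d + 1) + scale (e + 1) * b ≤ scale (e + 1) * a) ↔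
      (((factor e * p.1 + (3 * e + 3) : ℕ) : ℝ) ≤
        (ratOfTriple (a, b, d) : ℝ) * scale (e + 1)) := by
    have hd : (0 : ℝ) < d + 1 := by positivity
    simp only [ratOfTriple]
    rw [Rat.cast_div, div_mul_eq_mul_div]
    push_cast
    rw [le_div_iff₀ hd, ← @Nat.cast_le ℝ]
    push_cast
    constructor <;> intro h <;> linarith
  simp only [← h]
  simp [digits, Encodable.encode_prod_val]

theorem ratOfTriple_testPoint (e : ℕ) (p : ℕ × ℕ) :
    (ratOfTriple (testPoint e p) : ℝ) * scale (e + 1) =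
      factor e * p.1 + factor e * p.2 + 2 * (3 * e + 3) := by
  have hK : (0 : ℝ) < scale (e + 1) := by exact_mod_cast scale_pos (e + 1)
  have h : ((scale (e + 1) - 1 : ℕ) : ℝ) + 1 = scale (e + 1) := by
    exact_mod_cast Nat.sub_add_cancel (scale_pos (e + 1))
  simp only [ratOfTriple, testPoint]
  push_cast
  rw [h, div_mul_cancel₀ _ hK.ne']
  ring

theorem exists_leftCE_not_reducible_add :
    ∃ α β : ℝ, LeftCE α ∧ LeftCE β ∧ ¬ TotalSolovayReducible α (α + β) := by
  obtain ⟨α, hα, Hα⟩ := nested_fst.exists_limit (Primrec.fst.comp primrec_cell)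
  obtain ⟨β, hβ, Hβ⟩ := nested_snd.exists_limit (Primrec.snd.comp primrec_cell)
  refine ⟨α, β, hα, hβ, ?_⟩
  rintro ⟨c, hc0, f, ⟨F, hF, hfF⟩, hf⟩
  obtain ⟨C, hC⟩ := exists_code_of_computable hF
  obtain ⟨N, hN⟩ := exists_nat_ge c
  obtain ⟨e, he, hNe⟩ : ∃ e : ℕ, e.unpair.1 = Encodable.encode C ∧ N ≤ e :=
    -- The second component of `e` is padding: each code is tested at arbitrarily high levels, hence
    -- at one beyond `c`.
    ⟨Nat.pair (Encodable.encode C) N, by simp, Nat.right_le_pair _ _⟩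
  obtain ⟨p, s, hp⟩ := exists_refine_eq hC he
  have hK : (0 : ℝ) < scale (e + 1) := by exact_mod_cast scale_pos (e + 1)
  have hce : (c : ℝ) ≤ e := by
    have : c ≤ (e : ℚ) := hN.trans (by exact_mod_cast hNe)
    exact_mod_cast this
  have hc0' : (0 : ℝ) < c := by exact_mod_cast hc0
  obtain ⟨hα1, hα2⟩ := Hα (e + 1) _ s fun t ht => congrArg Prod.fst (hp t ht)
  obtain ⟨hβ1, hβ2⟩ := Hβ (e + 1) _ s fun t ht => congrArg Prod.snd (hp t ht)
  have hq := ratOfTriple_testPoint e p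
  have key := hf (ratOfTriple (testPoint e p))
  rw [hfF] at key
  rw [digits_encode] at hα1 hα2 hβ1 hβ2
  generalize (ratOfTriple (testPoint e p) : ℝ) = q at hq key
  generalize (ratOfTriple (F (testPoint e p)) : ℝ) = r at *
  have hlt : q < α + β := by
    refine lt_of_mul_lt_mul_right ?_ hK.le
    split_ifs at hα1 hβ1 <;> push_cast at hα1 hβ1 <;> linarith
  obtain ⟨h1, h2⟩ := key hlt
  replace h1 := mul_lt_mul_of_pos_right h1 hK
  replace h2 := mul_lt_mul_of_pos_right h2 hK
  have he0 : (0 : ℝ) ≤ e := Nat.cast_nonneg e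
  split_ifs at hα1 hα2 hβ1 hβ2 with hr
  -- On the fine grid, `α` is at most 2 and `r` at least `3e + 3` above the cell's left end, against
  -- `r < α`.
  · push_cast at hα2 hr
    linarith
  -- Here `α - r` exceeds `3e + 3` subcells, while `c (α + β - q)` is at most `3e` of them.
  · push_cast at hα1 hα2 hβ1 hβ2 hr
    have h3 : (α + β - q) * scale (e + 1) ≤ 3 := by linarith
    have h4 : (c : ℝ) * ((α + β - q) * scale (e + 1)) ≤ e * 3 :=
      (mul_le_mul_of_nonneg_left h3 hc0'.le).trans (by linarith)
    linarith

end SolovaySum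

theorem mainTheorem7 :
    (∃ α β : ℝ, LeftCE α ∧ LeftCE β ∧ ¬ TotalSolovayReducible α (α + β)) ∧
      (¬ ∀ α β : ℝ, LeftCE α → LeftCE β → IsTotalSolovayUpperBound α β (α + β)) ∧
      (¬ ∀ α β : ℝ, LeftCE α → LeftCE β → IsTotalSolovayJoin α β (α + β)) := by
  obtain ⟨α, β, hα, hβ, h⟩ := SolovaySum.exists_leftCE_not_reducible_add
  exact ⟨⟨α, β, hα, hβ, h⟩, fun H => h (H α β hα hβ).1, fun H => h (H α β hα hβ).2.1.1⟩
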